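/- Let $\mathbb{D}$ be the open unit disc, $\mathbb{T}$ the unit circle with normalized Lebesgue measure $m$, and $H^2$ the Hardy space of holomorphic functions $f$ on $\mathbb{D}$ with $\|f\|_2=\sup_{0\le r<1}\left(\int_{\mathbb{T}}|f(r\zeta)|^2\,dm(\zeta)\right)^{1/2}<\infty$, identified through boundary functions with the closed subspace of $L^2(\mathbb{T})$ of functions whose negative Fourier coefficients vanish. For $\varphi\in L^\infty(\mathbb{T})$ let $T_\varphi f=P_+(\varphi f)$, $f\in H^2$, where $P_+$ is the orthogonal projection of $L^2(\mathbb{T})$ onto $H^2$. A bounded operator $T$ on a Banach space $E$ is called embeddable into a $C_0$-semigroup on $E$ if there is a family $(T_t)_{t\ge 0}$ of bounded operators on $E$ with $T_0=\mathrm{Id}$, $T_{t+s}=T_tT_s$ for all $t,s\ge 0$, $t\mapsto T_tx$ continuous on $[0,\infty)$ for every $x\in E$, and $T_1=T$. Let $P$ be a nonzero polynomial with complex coefficients. Then the Toeplitz operator $T_P$, whose symbol is the restriction of $P$ to $\mathbb{T}$, is embeddable into a $C_0$-semigroup on $H^2$ if and only if $P$ has no zero in $\mathbb{D}$. -/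

import Mathlib

open scoped ENNReal NNReal Topology
open MeasureTheory

namespace HardyToeplitz

noncomputable section

/-- The mean `(∫_𝕋 |f(rζ)|² dm(ζ))^{1/2}`, where `m` is the normalized Lebesgue measure on the unit
circle `𝕋`. Throughout, `𝕋` is parametrized by `x ↦ ζ = exp (2πix)`, `x ∈ ℝ/ℤ`. -/
def circleMean (f : ℂ → ℂ) (r : ℝ) : ℝ :=
  Real.sqrt (∫ x : UnitAddCircle,
    ‖f (r * (AddCircle.toCircle x : ℂ))‖ ^ 2 ∂AddCircle.haarAddCircle)

/-- `f` belongs to the Hardy space `H²` of the unit disc. A function on the disc is encoded as a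
function on `ℂ` which vanishes off the disc, so that equality of functions on the disc is equality. -/
structure IsHardy (f : ℂ → ℂ) : Prop where
  differentiableOn : DifferentiableOn ℂ f (Metric.ball 0 1)
  eq_zero : ∀ z ∉ Metric.ball (0 : ℂ) 1, f z = 0
  bddAbove : BddAbove (Set.range fun r : Set.Ico (0 : ℝ) 1 => circleMean f r)

/-- The `n`-th Taylor coefficient of `f` at `0`. -/
def taylorCoeff (f : ℂ → ℂ) (n : ℕ) : ℂ := ((n.factorial : ℂ))⁻¹ * iteratedDeriv n f 0

/-- The Fourier coefficients of the boundary function of `f`: the Taylor coefficients of `f` at the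
indices `n ≥ 0`, and zero at the negative ones. -/
def boundaryCoeff (f : ℂ → ℂ) : ℤ → ℂ
  | Int.ofNat n => taylorCoeff f n
  | Int.negSucc _ => 0

theorem hasSum_taylorCoeff {f : ℂ → ℂ} (hf : DifferentiableOn ℂ f (Metric.ball 0 1)) {z : ℂ}
    (hz : z ∈ Metric.ball (0 : ℂ) 1) : HasSum (fun n => taylorCoeff f n * z ^ n) (f z) := by
  have := Complex.hasSum_taylorSeries_on_ball (c := 0) (r := 1) (by simpa using hf)
    (z := z) (by simpa using hz)
  have e : (fun n => taylorCoeff f n * z ^ n)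
      = fun n : ℕ => ((n.factorial : ℂ))⁻¹ • (z - 0) ^ n • iteratedDeriv n f 0 := by
    ext n
    rw [sub_zero, smul_eq_mul, smul_eq_mul]
    simp only [taylorCoeff]
    ring
  rw [e]
  exact this

theorem mul_toCircle_mem {r : ℝ} (hr : r ∈ Set.Ico (0 : ℝ) 1) (x : UnitAddCircle) :
    (r : ℂ) * (AddCircle.toCircle x : ℂ) ∈ Metric.ball (0 : ℂ) 1 := by
  rw [mem_ball_zero_iff, norm_mul, Complex.norm_real, Circle.norm_coe, mul_one,
    Real.norm_of_nonneg hr.1]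
  exact hr.2

theorem continuous_dilate {f : ℂ → ℂ} (hf : DifferentiableOn ℂ f (Metric.ball 0 1)) {r : ℝ}
    (hr : r ∈ Set.Ico (0 : ℝ) 1) :
    Continuous fun x : UnitAddCircle => f (r * (AddCircle.toCircle x : ℂ)) := by
  refine hf.continuousOn.comp_continuous ?_ (mul_toCircle_mem hr)
  exact continuous_const.mul (continuous_subtype_val.comp AddCircle.continuous_toCircle)

/-- The continuous function `ζ ↦ f(rζ)` on the circle. -/
def dilate {f : ℂ → ℂ} (hf : DifferentiableOn ℂ f (Metric.ball 0 1)) {r : ℝ}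
    (hr : r ∈ Set.Ico (0 : ℝ) 1) : C(UnitAddCircle, ℂ) := ⟨_, continuous_dilate hf hr⟩

theorem hasSum_dilate {f : ℂ → ℂ} (hf : DifferentiableOn ℂ f (Metric.ball 0 1)) {r : ℝ}
    (hr : r ∈ Set.Ico (0 : ℝ) 1) :
    HasSum (fun n : ℕ => (taylorCoeff f n * r ^ n) • (fourier (n : ℤ) : C(UnitAddCircle, ℂ)))
      (dilate hf hr) := by
  have hs : Summable (fun n : ℕ =>
      (taylorCoeff f n * r ^ n) • (fourier (n : ℤ) : C(UnitAddCircle, ℂ))) := by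
    refine Summable.of_norm ?_
    have h := (hasSum_taylorCoeff hf (z := (r : ℂ))
      (by simp [abs_of_nonneg hr.1, hr.2])).summable.norm
    refine h.congr fun n => ?_
    rw [norm_smul, fourier_norm, mul_one]
  obtain ⟨g, hg⟩ := hs
  convert hg
  ext x
  have h1 := ContinuousMap.hasSum_apply hg x
  have h2 := hasSum_taylorCoeff hf (mul_toCircle_mem hr x)
  refine h2.unique ?_
  convert h1 using 2 with n
  simp [fourier_apply, mul_pow, AddCircle.toCircle_nsmul, mul_assoc]

theorem repr_dilate {f : ℂ → ℂ} (hf : DifferentiableOn ℂ f (Metric.ball 0 1)) {r : ℝ}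
    (hr : r ∈ Set.Ico (0 : ℝ) 1) (k : ℤ) :
    fourierBasis.repr (ContinuousMap.toLp 2 AddCircle.haarAddCircle ℂ (dilate hf hr)) k
      = boundaryCoeff f k * r ^ k.natAbs := by
  have h := (hasSum_dilate hf hr).mapL
    ((innerSL ℂ (fourierBasis (T := 1) k)).comp
      (ContinuousMap.toLp 2 AddCircle.haarAddCircle ℂ))
  rw [HilbertBasis.repr_apply_apply]
  refine h.unique ?_
  have key : ∀ n : ℕ, ((innerSL ℂ (fourierBasis (T := 1) k)).comp
      (ContinuousMap.toLp 2 AddCircle.haarAddCircle ℂ))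
      ((taylorCoeff f n * r ^ n) • (fourier (n : ℤ) : C(UnitAddCircle, ℂ)))
      = if (n : ℤ) = k then boundaryCoeff f k * r ^ k.natAbs else 0 := by
    intro n
    have h3 : ContinuousMap.toLp 2 AddCircle.haarAddCircle ℂ
        (fourier (n : ℤ) : C(UnitAddCircle, ℂ)) = fourierBasis (T := 1) n := by
      rw [coe_fourierBasis]
    rw [map_smul, ContinuousLinearMap.comp_apply, h3, innerSL_apply_apply,
      orthonormal_iff_ite.mp (fourierBasis (T := 1)).orthonormal k n]
    by_cases hk : (n : ℤ) = k
    · subst hk; simp [boundaryCoeff]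
    · simp [hk, Ne.symm hk]
  simp_rw [key]
  cases k with
  | ofNat m =>
    have := hasSum_ite_eq (m : ℕ) (boundaryCoeff f (Int.ofNat m) * (r : ℂ) ^ (Int.ofNat m).natAbs)
    simpa using this
  | negSucc m => 
    simp [boundaryCoeff, hasSum_zero]

theorem hasSum_circleMean {f : ℂ → ℂ} (hf : DifferentiableOn ℂ f (Metric.ball 0 1)) {r : ℝ}
    (hr : r ∈ Set.Ico (0 : ℝ) 1) :
    HasSum (fun k : ℤ => (‖boundaryCoeff f k‖ * r ^ k.natAbs) ^ 2) (circleMean f r ^ 2) := by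
  have h := hasSum_sq_fourierCoeff
    (ContinuousMap.toLp 2 AddCircle.haarAddCircle ℂ (dilate hf hr))
  rw [circleMean, Real.sq_sqrt (integral_nonneg fun x => by positivity)]
  convert h using 1
  · ext k
    rw [← fourierBasis_repr, repr_dilate, norm_mul, norm_pow, Complex.norm_real,
      Real.norm_of_nonneg hr.1]
  · refine integral_congr_ae ?_
    filter_upwards [ContinuousMap.coeFn_toLp (𝕜 := ℂ) (p := 2) AddCircle.haarAddCircle
      (dilate hf hr)] with x hx
    rw [hx]; rfl

theorem circleMean_nonneg (f : ℂ → ℂ) (r : ℝ) : 0 ≤ circleMean f r := Real.sqrt_nonneg _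

theorem sum_boundaryCoeff_le {f : ℂ → ℂ} (hf : DifferentiableOn ℂ f (Metric.ball 0 1)) {C : ℝ}
    (hC : ∀ r ∈ Set.Ico (0 : ℝ) 1, circleMean f r ≤ C) (s : Finset ℤ) :
    ∑ k ∈ s, ‖boundaryCoeff f k‖ ^ 2 ≤ C ^ 2 := by
  have hlim : Filter.Tendsto
      (fun r : ℝ => ∑ k ∈ s, (‖boundaryCoeff f k‖ * r ^ k.natAbs) ^ 2) (𝓝[<] 1)
      (𝓝 (∑ k ∈ s, ‖boundaryCoeff f k‖ ^ 2)) := by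
    have : Continuous fun r : ℝ => ∑ k ∈ s, (‖boundaryCoeff f k‖ * r ^ k.natAbs) ^ 2 := by
      fun_prop
    have h := (this.tendsto 1).mono_left (nhdsWithin_le_nhds (s := Set.Iio 1))
    simpa using h
  refine le_of_tendsto hlim ?_
  filter_upwards [Ico_mem_nhdsLT (show (0 : ℝ) < 1 by norm_num)] with r hr
  refine (sum_le_hasSum s (fun _ _ => by positivity) (hasSum_circleMean hf hr)).trans ?_
  exact pow_le_pow_left₀ (circleMean_nonneg f r) (hC r hr) 2

theorem summable_boundaryCoeff {f : ℂ → ℂ} (hf : IsHardy f) :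
    Summable fun k : ℤ => ‖boundaryCoeff f k‖ ^ 2 := by
  obtain ⟨C, hC⟩ := hf.bddAbove
  exact summable_of_sum_le (fun _ => by positivity)
    (sum_boundaryCoeff_le hf.differentiableOn fun r hr => hC ⟨⟨r, hr⟩, rfl⟩)

theorem circleMean_sq_le {f : ℂ → ℂ} (hf : DifferentiableOn ℂ f (Metric.ball 0 1))
    (hs : Summable fun k : ℤ => ‖boundaryCoeff f k‖ ^ 2) {r : ℝ} (hr : r ∈ Set.Ico (0 : ℝ) 1) :
    circleMean f r ^ 2 ≤ ∑' k, ‖boundaryCoeff f k‖ ^ 2 := by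
  rw [← (hasSum_circleMean hf hr).tsum_eq]
  refine (hasSum_circleMean hf hr).summable.tsum_le_tsum (fun k => ?_) hs
  refine pow_le_pow_left₀ (mul_nonneg (norm_nonneg _) (pow_nonneg hr.1 _)) ?_ 2
  exact mul_le_of_le_one_right (norm_nonneg _) (pow_le_one₀ hr.1 hr.2.le)

theorem iSup_circleMean_sq {f : ℂ → ℂ} (hf : IsHardy f) :
    (⨆ r : Set.Ico (0 : ℝ) 1, circleMean f r) ^ 2 = ∑' k, ‖boundaryCoeff f k‖ ^ 2 := by
  have : Nonempty (Set.Ico (0 : ℝ) 1) := ⟨⟨0, by simp⟩⟩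
  refine le_antisymm ?_ ?_
  · rw [← Real.sq_sqrt (tsum_nonneg fun k => by positivity :
      0 ≤ ∑' k, ‖boundaryCoeff f k‖ ^ 2)]
    refine pow_le_pow_left₀ (Real.iSup_nonneg fun r => circleMean_nonneg f _) ?_ 2
    refine ciSup_le fun r => Real.le_sqrt_of_sq_le ?_
    exact circleMean_sq_le hf.differentiableOn (summable_boundaryCoeff hf) r.2
  · refine Real.tsum_le_of_sum_le (fun _ => by positivity) ?_
    exact sum_boundaryCoeff_le hf.differentiableOn fun r hr => le_ciSup hf.bddAbove ⟨r, hr⟩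

theorem isHardy_of_summable {f : ℂ → ℂ} (hf : DifferentiableOn ℂ f (Metric.ball 0 1))
    (h0 : ∀ z ∉ Metric.ball (0 : ℂ) 1, f z = 0)
    (hs : Summable fun k : ℤ => ‖boundaryCoeff f k‖ ^ 2) : IsHardy f := by
  refine ⟨hf, h0, Real.sqrt (∑' k, ‖boundaryCoeff f k‖ ^ 2), ?_⟩
  rintro _ ⟨r, rfl⟩
  exact Real.le_sqrt_of_sq_le (circleMean_sq_le hf hs r.2)

theorem taylorCoeff_add {f g : ℂ → ℂ} (hf : DifferentiableOn ℂ f (Metric.ball 0 1))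
    (hg : DifferentiableOn ℂ g (Metric.ball 0 1)) (n : ℕ) :
    taylorCoeff (f + g) n = taylorCoeff f n + taylorCoeff g n := by
  have h : ∀ {f : ℂ → ℂ}, DifferentiableOn ℂ f (Metric.ball 0 1) → ContDiffAt ℂ n f 0 :=
    fun hf => (hf.contDiffOn Metric.isOpen_ball).contDiffAt
      (Metric.ball_mem_nhds _ one_pos)
  rw [taylorCoeff, iteratedDeriv_add (h hf) (h hg), mul_add]; rfl

theorem taylorCoeff_smul {f : ℂ → ℂ} (c : ℂ) (n : ℕ) :
    taylorCoeff (c • f) n = c * taylorCoeff f n := by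
  rw [taylorCoeff, iteratedDeriv_const_smul_field, taylorCoeff, smul_eq_mul]; ring

theorem boundaryCoeff_add {f g : ℂ → ℂ} (hf : DifferentiableOn ℂ f (Metric.ball 0 1))
    (hg : DifferentiableOn ℂ g (Metric.ball 0 1)) (k : ℤ) :
    boundaryCoeff (f + g) k = boundaryCoeff f k + boundaryCoeff g k := by
  cases k <;> simp [boundaryCoeff, taylorCoeff_add hf hg]

theorem boundaryCoeff_smul {f : ℂ → ℂ} (c : ℂ) (k : ℤ) :
    boundaryCoeff (c • f) k = c * boundaryCoeff f k := by
  cases k <;> simp [boundaryCoeff, taylorCoeff_smul]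

theorem memℓp_boundaryCoeff {f : ℂ → ℂ} (hf : IsHardy f) : Memℓp (boundaryCoeff f) 2 :=
  memℓp_gen (by simpa using summable_boundaryCoeff hf)

theorem IsHardy.add {f g : ℂ → ℂ} (hf : IsHardy f) (hg : IsHardy g) : IsHardy (f + g) := by
  refine isHardy_of_summable (hf.differentiableOn.add hg.differentiableOn)
    (fun z hz => by simp [hf.eq_zero z hz, hg.eq_zero z hz]) ?_
  have h := (memℓp_boundaryCoeff hf).add (memℓp_boundaryCoeff hg)
  have h2 := (memℓp_gen_iff (by norm_num)).1 h
  simpa [boundaryCoeff_add hf.differentiableOn hg.differentiableOn] using h2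

theorem IsHardy.smul {f : ℂ → ℂ} (c : ℂ) (hf : IsHardy f) : IsHardy (c • f) := by
  refine isHardy_of_summable (hf.differentiableOn.const_smul c)
    (fun z hz => by simp [hf.eq_zero z hz]) ?_
  simpa [boundaryCoeff_smul, mul_pow] using (summable_boundaryCoeff hf).mul_left (‖c‖ ^ 2)

theorem IsHardy.zero : IsHardy 0 := by
  refine ⟨differentiableOn_const 0, fun _ _ => rfl, 0, ?_⟩
  rintro _ ⟨r, rfl⟩
  simp [circleMean]

/-- The vector space of the functions in `H²`. -/
def hardySubmodule : Submodule ℂ (ℂ → ℂ) where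
  carrier := {f | IsHardy f}
  add_mem' := IsHardy.add
  zero_mem' := IsHardy.zero
  smul_mem' c _ hf := hf.smul c

/-- The Hardy space `H²` of the unit disc, with the norm
`‖f‖ = sup_{0 ≤ r < 1} (∫_𝕋 |f(rζ)|² dm(ζ))^{1/2}`. -/
def HardySpace : Type := hardySubmodule

namespace HardySpace

instance : AddCommGroup HardySpace := inferInstanceAs (AddCommGroup hardySubmodule)

instance : Module ℂ HardySpace := inferInstanceAs (Module ℂ hardySubmodule)

instance : CoeFun HardySpace (fun _ => ℂ → ℂ) := ⟨fun f => f.1⟩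

theorem isHardy (f : HardySpace) : IsHardy f := f.2

@[ext]
theorem ext {f g : HardySpace} (h : ∀ z ∈ Metric.ball (0 : ℂ) 1, f z = g z) : f = g := by
  refine Subtype.ext (funext fun z => ?_)
  by_cases hz : z ∈ Metric.ball (0 : ℂ) 1
  · exact h z hz
  · rw [f.isHardy.eq_zero z hz, g.isHardy.eq_zero z hz]

instance : Norm HardySpace := ⟨fun f => ⨆ r : Set.Ico (0 : ℝ) 1, circleMean f r⟩

theorem norm_def (f : HardySpace) : ‖f‖ = ⨆ r : Set.Ico (0 : ℝ) 1, circleMean f r := rfl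

/-- The boundary function in `L²(𝕋)` of a function in `H²`, as a linear map. -/
def boundaryₗ : HardySpace →ₗ[ℂ] Lp ℂ 2 (@AddCircle.haarAddCircle 1 _) where
  toFun f := fourierBasis.repr.symm ⟨boundaryCoeff f, memℓp_boundaryCoeff f.isHardy⟩
  map_add' f g := by
    rw [← map_add]
    congr 1
    ext k
    exact boundaryCoeff_add f.isHardy.differentiableOn g.isHardy.differentiableOn k
  map_smul' c f := by
    rw [RingHom.id_apply, ← map_smul]
    congr 1
    ext k
    exact boundaryCoeff_smul c k

theorem repr_boundaryₗ (f : HardySpace) (k : ℤ) :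
    fourierBasis.repr (boundaryₗ f) k = boundaryCoeff f k := by
  simp [boundaryₗ]

theorem norm_boundaryₗ (f : HardySpace) : ‖boundaryₗ f‖ = ‖f‖ := by
  have h0 : 0 ≤ ‖f‖ := Real.iSup_nonneg fun r => circleMean_nonneg f r
  rw [← sq_eq_sq₀ (norm_nonneg _) h0, norm_def, iSup_circleMean_sq f.isHardy,
    ← fourierBasis.repr.norm_map, lp.norm_eq_tsum_rpow (by norm_num)]
  simp only [repr_boundaryₗ]
  have h1 : 0 ≤ ∑' k, ‖boundaryCoeff f k‖ ^ 2 := tsum_nonneg fun k => by positivity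
  have := Real.sq_sqrt h1
  rw [Real.sqrt_eq_rpow] at this
  simpa using this

theorem boundaryₗ_injective : Function.Injective boundaryₗ := by
  rw [injective_iff_map_eq_zero]
  intro f hf
  ext z hz
  have h := hasSum_taylorCoeff f.isHardy.differentiableOn hz
  have h1 : ∀ n, taylorCoeff f n = 0 := fun n => by
    have := repr_boundaryₗ f (n : ℤ)
    rw [hf] at this
    simpa [boundaryCoeff] using this.symm
  simp only [h1, zero_mul] at h
  exact h.unique hasSum_zero

instance : NormedAddCommGroup HardySpace :=
  NormedAddCommGroup.ofCore (𝕜 := ℂ)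
    { norm_nonneg := fun f => by rw [← norm_boundaryₗ]; exact norm_nonneg _
      norm_smul := fun c f => by
        rw [← norm_boundaryₗ, ← norm_boundaryₗ, map_smul, norm_smul]
      norm_triangle := fun f g => by
        simp only [← norm_boundaryₗ, map_add]; exact norm_add_le _ _
      norm_eq_zero_iff := fun f => by
        rw [← norm_boundaryₗ, norm_eq_zero, map_eq_zero_iff _ boundaryₗ_injective] }

instance : NormedSpace ℂ HardySpace where
  norm_smul_le c f := by rw [← norm_boundaryₗ, ← norm_boundaryₗ, map_smul, norm_smul]

/-- The boundary function in `L²(𝕋)` of `f ∈ H²`, as a linear isometry. It is the limit in `L²(𝕋)` of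
`ζ ↦ f(rζ)` as `r → 1`, see `tendsto_boundary`. -/
def boundary : HardySpace →ₗᵢ[ℂ] Lp ℂ 2 (@AddCircle.haarAddCircle 1 _) where
  toLinearMap := boundaryₗ
  norm_map' := norm_boundaryₗ

theorem repr_boundary (f : HardySpace) (k : ℤ) :
    fourierBasis.repr (boundary f) k = boundaryCoeff f k := repr_boundaryₗ f k

/-- The boundary function is the limit of the dilates in `L²(𝕋)`. -/
theorem tendsto_boundary (f : HardySpace) :
    Filter.Tendsto
      (fun r : Set.Ico (0 : ℝ) 1 => ContinuousMap.toLp 2 AddCircle.haarAddCircle ℂ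
        (dilate f.isHardy.differentiableOn r.2))
      (Filter.comap Subtype.val (𝓝 (1 : ℝ))) (𝓝 (boundary f)) := by
  have hn : ∀ r : Set.Ico (0 : ℝ) 1,
      ‖ContinuousMap.toLp 2 AddCircle.haarAddCircle ℂ (dilate f.isHardy.differentiableOn r.2)
        - boundary f‖ ^ 2 = ∑' k : ℤ, (‖boundaryCoeff f k‖ * ((r : ℝ) ^ k.natAbs - 1)) ^ 2 := by
    intro r
    rw [← fourierBasis.repr.norm_map, map_sub, lp.norm_eq_tsum_rpow (by norm_num)]
    have h1 : ∀ k : ℤ, ‖(fourierBasis.repr (ContinuousMap.toLp 2 AddCircle.haarAddCircle ℂ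
        (dilate f.isHardy.differentiableOn r.2)) - fourierBasis.repr (boundary f)) k‖
        ^ (2 : ℝ≥0∞).toReal = (‖boundaryCoeff f k‖ * ((r : ℝ) ^ k.natAbs - 1)) ^ 2 := by
      intro k
      rw [lp.coeFn_sub, Pi.sub_apply, repr_dilate, repr_boundary]
      have : boundaryCoeff f k * ((r : ℝ) : ℂ) ^ k.natAbs - boundaryCoeff f k
          = boundaryCoeff f k * (((r : ℝ) ^ k.natAbs - 1 : ℝ) : ℂ) := by push_cast; ring
      rw [this, norm_mul, Complex.norm_real]
      simp [mul_pow]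
    simp only [h1]
    have h2 : 0 ≤ ∑' k : ℤ, (‖boundaryCoeff f k‖ * ((r : ℝ) ^ k.natAbs - 1)) ^ 2 :=
      tsum_nonneg fun k => by positivity
    have := Real.sq_sqrt h2
    rw [Real.sqrt_eq_rpow] at this
    simpa using this
  rw [tendsto_iff_norm_sub_tendsto_zero]
  have hsq : Filter.Tendsto
      (fun r : Set.Ico (0 : ℝ) 1 => ∑' k : ℤ,
        (‖boundaryCoeff f k‖ * ((r : ℝ) ^ k.natAbs - 1)) ^ 2)
      (Filter.comap Subtype.val (𝓝 (1 : ℝ))) (𝓝 (∑' _ : ℤ, (0 : ℝ))) := by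
    refine tendsto_tsum_of_dominated_convergence (summable_boundaryCoeff f.isHardy) ?_ ?_
    · intro k
      have hc : Continuous fun r : ℝ => (‖boundaryCoeff f k‖ * (r ^ k.natAbs - 1)) ^ 2 := by
        fun_prop
      have := (hc.tendsto 1).comp
        (Filter.tendsto_comap (f := (Subtype.val : Set.Ico (0 : ℝ) 1 → ℝ)) (x := 𝓝 1))
      simpa [Function.comp_def] using this
    · refine Filter.Eventually.of_forall fun r k => ?_
      have h0 : 0 ≤ (r : ℝ) ^ k.natAbs := pow_nonneg r.2.1 _
      have h1 : (r : ℝ) ^ k.natAbs ≤ 1 := pow_le_one₀ r.2.1 r.2.2.le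
      rw [Real.norm_of_nonneg (by positivity), mul_pow]
      exact mul_le_of_le_one_right (by positivity) (by nlinarith)
  have := hsq.sqrt
  simp only [tsum_zero, Real.sqrt_zero] at this
  refine this.congr fun r => ?_
  rw [← hn, Real.sqrt_sq (norm_nonneg _)]

end HardySpace

/-- `H²` as the closed subspace of `L²(𝕋)` of the functions without negative Fourier coefficients. -/
def hardyBoundary : Submodule ℂ (Lp ℂ 2 (@AddCircle.haarAddCircle 1 _)) where
  carrier := {F | ∀ k : ℤ, k < 0 → fourierCoeff F k = 0}
  add_mem' {F G} hF hG k hk := by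
    have := hF k hk
    have := hG k hk
    simp only [← fourierBasis_repr] at *
    simp [*]
  zero_mem' k hk := by
    simp only [← fourierBasis_repr]
    simp
  smul_mem' c F hF k hk := by
    have := hF k hk
    simp only [← fourierBasis_repr] at *
    simp [*]

theorem mem_hardyBoundary {F : Lp ℂ 2 (@AddCircle.haarAddCircle 1 _)} :
    F ∈ hardyBoundary ↔ ∀ k : ℤ, k < 0 → fourierBasis.repr F k = 0 := by
  simp only [fourierBasis_repr]; rfl

theorem HardySpace.boundary_mem (f : HardySpace) : HardySpace.boundary f ∈ hardyBoundary := by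
  rw [mem_hardyBoundary]
  intro k hk
  rw [HardySpace.repr_boundary]
  cases k with
  | ofNat n => exact absurd hk (by simp)
  | negSucc n => rfl

theorem HardySpace.exists_boundary_eq {F : Lp ℂ 2 (@AddCircle.haarAddCircle 1 _)}
    (hF : F ∈ hardyBoundary) : ∃ f : HardySpace, HardySpace.boundary f = F := by
  set c : ℕ → ℂ := fun n => fourierBasis.repr F n with hc
  set p : FormalMultilinearSeries ℂ ℂ ℂ := FormalMultilinearSeries.ofScalars ℂ c with hp
  have hrad : (1 : ℝ≥0∞) ≤ p.radius := by
    have := p.le_radius_of_bound (r := 1) ‖F‖ (fun n => by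
      rw [hp, FormalMultilinearSeries.ofScalars_norm]
      have := lp.norm_apply_le_norm (by norm_num) (fourierBasis.repr F) (n : ℤ)
      simpa using this)
    simpa using this
  have hps : HasFPowerSeriesOnBall p.sum p 0 1 :=
    (p.hasFPowerSeriesOnBall (one_pos.trans_le hrad)).mono one_pos hrad
  set g : ℂ → ℂ := (Metric.ball (0 : ℂ) 1).indicator p.sum with hg
  have hgs : HasFPowerSeriesOnBall g p 0 1 := by
    refine hps.congr fun z hz => ?_
    have : z ∈ Metric.ball (0 : ℂ) 1 := by
      rwa [← ENNReal.ofReal_one, Metric.eball_ofReal] at hz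
    rw [hg, Set.indicator_of_mem this]
  have hd : DifferentiableOn ℂ g (Metric.ball 0 1) := by
    have := hgs.differentiableOn
    rwa [← ENNReal.ofReal_one, Metric.eball_ofReal] at this
  have ht : ∀ n, taylorCoeff g n = c n := by
    intro n
    have h := hgs.factorial_smul (1 : ℂ) n
    rw [taylorCoeff, iteratedDeriv_eq_iteratedFDeriv, ← h, hp]
    simp [Nat.factorial_ne_zero]
  have hb : ∀ k : ℤ, boundaryCoeff g k = fourierBasis.repr F k := by
    intro k
    cases k with
    | ofNat n => exact ht n
    | negSucc n => exact (mem_hardyBoundary.1 hF _ (Int.negSucc_lt_zero n)).symm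
  have hs : Summable fun k : ℤ => ‖boundaryCoeff g k‖ ^ 2 := by
    simp only [hb]
    have := (memℓp_gen_iff (by norm_num)).1 (lp.memℓp (fourierBasis.repr F))
    simpa using this
  let f : HardySpace := ⟨g, isHardy_of_summable hd (fun z hz => Set.indicator_of_notMem hz _) hs⟩
  refine ⟨f, ?_⟩
  apply fourierBasis.repr.injective
  ext k
  exact (HardySpace.repr_boundary f k).trans (hb k)

/-- The identification of `H²` with a closed subspace of `L²(𝕋)` through boundary functions. -/
def boundaryEquiv : HardySpace ≃ₗᵢ[ℂ] hardyBoundary :=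
  LinearIsometryEquiv.ofSurjective
    { toLinearMap := HardySpace.boundary.toLinearMap.codRestrict hardyBoundary
        HardySpace.boundary_mem
      norm_map' := HardySpace.boundary.norm_map }
    (fun F => by
      obtain ⟨f, hf⟩ := HardySpace.exists_boundary_eq F.2
      exact ⟨f, Subtype.ext hf⟩)

theorem isClosed_hardyBoundary :
    IsClosed (hardyBoundary : Set (Lp ℂ 2 (@AddCircle.haarAddCircle 1 _))) := by
  have : (hardyBoundary : Set (Lp ℂ 2 (@AddCircle.haarAddCircle 1 _)))
      = ⋂ k : ℤ, ⋂ _ : k < 0, {F | inner ℂ (fourierBasis (T := 1) k) F = 0} := by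
    ext F
    simp only [SetLike.mem_coe, mem_hardyBoundary, HilbertBasis.repr_apply_apply,
      Set.mem_iInter, Set.mem_ofPred_eq]
  rw [this]
  refine isClosed_iInter fun k => isClosed_iInter fun _ => ?_
  exact isClosed_eq (by fun_prop) continuous_const

instance : CompleteSpace hardyBoundary := isClosed_hardyBoundary.completeSpace_coe

instance : CompleteSpace HardySpace :=
  boundaryEquiv.toIsometryEquiv.completeSpace_iff.2 inferInstance

/-- The Toeplitz operator `T_φ f = P₊ (φ f)` on `H²` with symbol `φ ∈ L^∞(𝕋)`, where `P₊` is the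
orthogonal projection of `L²(𝕋)` onto `H²`. -/
def toeplitz (φ : Lp ℂ ∞ (@AddCircle.haarAddCircle 1 _)) : HardySpace →L[ℂ] HardySpace :=
  boundaryEquiv.symm.toContinuousLinearEquiv.toContinuousLinearMap ∘L
    hardyBoundary.orthogonalProjectionOnto ∘L
    ((ContinuousLinearMap.mul ℂ ℂ).holderL AddCircle.haarAddCircle ∞ 2 2 φ) ∘L
    hardyBoundary.subtypeL ∘L
    boundaryEquiv.toContinuousLinearEquiv.toContinuousLinearMap

/-- The restriction of a polynomial to the unit circle, as an element of `L^∞(𝕋)`. -/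
def polynomialSymbol (P : Polynomial ℂ) : Lp ℂ ∞ (@AddCircle.haarAddCircle 1 _) :=
  ContinuousMap.toLp ∞ AddCircle.haarAddCircle ℂ
    ⟨fun x => P.eval (AddCircle.toCircle x : ℂ),
      P.continuous.comp (continuous_subtype_val.comp AddCircle.continuous_toCircle)⟩

/-- A strongly continuous semigroup `(S t)_{t ≥ 0}` of bounded linear operators. -/
structure IsC0Semigroup {E : Type*} [NormedAddCommGroup E] [NormedSpace ℂ E]
    (S : ℝ≥0 → E →L[ℂ] E) : Prop where
  map_zero : S 0 = ContinuousLinearMap.id ℂ E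
  map_add : ∀ t s, S (t + s) = S t ∘L S s
  continuous : ∀ x, Continuous fun t => S t x

/-- A bounded operator is embeddable into a `C₀`-semigroup `S` if it equals `S 1`. -/
def IsEmbeddable {E : Type*} [NormedAddCommGroup E] [NormedSpace ℂ E] (A : E →L[ℂ] E) : Prop :=
  ∃ S : ℝ≥0 → E →L[ℂ] E, IsC0Semigroup S ∧ S 1 = A

end
end HardyToeplitz

namespace HardyToeplitz

noncomputable section

open Metric (ball)

/-! A polynomial multiplies $H^2$ into itself, so $T_P$ is multiplication by $P$
(`toeplitz_polynomialSymbol`).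

Necessity is a codimension argument, phrased with functionals annihilating ranges. If $T_1$ belongs
to a $C_0$-semigroup, the annihilators of the ranges of $T_t$ shrink as $t \to 0$. If that of $T_1$
is finite-dimensional, they are eventually constant; strong continuity at $0$ makes the constant
value zero, and taking powers gives zero for $T_1$ as well (`IsC0Semigroup.annihilator_one_eq_bot`).
For multiplication by $P$ the annihilator has dimension at most $\deg P$, by Euclidean division and
density of polynomials, while evaluation at a zero of $P$ in the disc would be a nonzero element of
it.

Sufficiency: a zero-free $P$ equals $e^L$ on the disc, with $\mathrm{Re}\, L = \log|P|$ bounded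
above, and multiplication by $e^{tL}$ is the semigroup. Since $L$ may be unbounded near zeros of $P$
on the circle, norm continuity is not to be expected. Strong continuity at $0$ comes from pointwise
convergence and the bound $e^{tB}\|f\| \to \|f\|$ (`tendsto_of_tendsto_apply_of_norm_le`). -/

/-! ### Multiplication by bounded holomorphic functions, and point evaluations -/

theorem circleMean_mul_le {h f : ℂ → ℂ} (hh : DifferentiableOn ℂ h (ball 0 1))
    (hf : DifferentiableOn ℂ f (ball 0 1)) {C : ℝ} (hC : ∀ z ∈ ball (0 : ℂ) 1, ‖h z‖ ≤ C) {r : ℝ}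
    (hr : r ∈ Set.Ico (0 : ℝ) 1) : circleMean (h * f) r ≤ C * circleMean f r := by
  have hC0 : 0 ≤ C := (norm_nonneg _).trans (hC 0 (by simp))
  rw [circleMean, circleMean, ← Real.sqrt_sq hC0, ← Real.sqrt_mul (sq_nonneg C),
    ← integral_const_mul]
  refine Real.sqrt_le_sqrt (integral_mono ?_ ?_ fun x => ?_)
  · exact ((continuous_dilate (hh.mul hf) hr).norm.pow 2).integrable_of_hasCompactSupport
      (HasCompactSupport.of_compactSpace _)
  · exact (((continuous_dilate hf hr).norm.pow 2).const_mul
      (C ^ 2)).integrable_of_hasCompactSupport (HasCompactSupport.of_compactSpace _)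
  · simp only [Pi.mul_apply, norm_mul, mul_pow]
    gcongr
    exact hC _ (mul_toCircle_mem hr x)

theorem IsHardy.mul_left {h f : ℂ → ℂ} (hh : DifferentiableOn ℂ h (ball 0 1)) {C : ℝ}
    (hC : ∀ z ∈ ball (0 : ℂ) 1, ‖h z‖ ≤ C) (hf : IsHardy f) : IsHardy (h * f) := by
  have hC0 : 0 ≤ C := (norm_nonneg _).trans (hC 0 (by simp))
  obtain ⟨B, hB⟩ := hf.bddAbove
  refine ⟨hh.mul hf.differentiableOn, fun z hz => by simp [hf.eq_zero z hz], C * B, ?_⟩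
  rintro _ ⟨r, rfl⟩
  exact (circleMean_mul_le hh hf.differentiableOn hC r.2).trans
    (mul_le_mul_of_nonneg_left (hB ⟨r, rfl⟩) hC0)

namespace HardySpace

theorem add_apply (f g : HardySpace) (z : ℂ) : (f + g) z = f z + g z := rfl

theorem smul_apply (c : ℂ) (f : HardySpace) (z : ℂ) : (c • f) z = c * f z := rfl

theorem circleMean_le_norm (f : HardySpace) {r : ℝ} (hr : r ∈ Set.Ico (0 : ℝ) 1) :
    circleMean f r ≤ ‖f‖ := le_ciSup f.isHardy.bddAbove ⟨r, hr⟩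

/-- Multiplication by a bounded holomorphic function on the Hardy space. -/
def mulOp (h : ℂ → ℂ) (hh : DifferentiableOn ℂ h (ball 0 1)) (C : ℝ)
    (hC : ∀ z ∈ ball (0 : ℂ) 1, ‖h z‖ ≤ C) : HardySpace →L[ℂ] HardySpace :=
  LinearMap.mkContinuous
    { toFun := fun f => ⟨h * f.1, f.isHardy.mul_left hh hC⟩
      map_add' := fun f g => Subtype.ext (mul_add h f.1 g.1)
      map_smul' := fun c f => Subtype.ext (mul_smul_comm c h f.1) }
    C (fun f => by
      have : Nonempty (Set.Ico (0 : ℝ) 1) := ⟨⟨0, by simp⟩⟩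
      have hC0 : 0 ≤ C := (norm_nonneg _).trans (hC 0 (by simp))
      refine ciSup_le fun r => ?_
      exact (circleMean_mul_le hh f.isHardy.differentiableOn hC r.2).trans
        (mul_le_mul_of_nonneg_left (f.circleMean_le_norm r.2) hC0))

theorem mulOp_apply {h : ℂ → ℂ} (hh : DifferentiableOn ℂ h (ball 0 1)) {C : ℝ}
    (hC : ∀ z ∈ ball (0 : ℂ) 1, ‖h z‖ ≤ C) (f : HardySpace) (z : ℂ) :
    mulOp h hh C hC f z = h z * f z := rfl

theorem norm_mulOp_le {h : ℂ → ℂ} (hh : DifferentiableOn ℂ h (ball 0 1)) {C : ℝ}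
    (hC : ∀ z ∈ ball (0 : ℂ) 1, ‖h z‖ ≤ C) : ‖mulOp h hh C hC‖ ≤ C :=
  LinearMap.mkContinuous_norm_le _ ((norm_nonneg _).trans (hC 0 (by simp))) _

theorem norm_taylorCoeff_le (f : HardySpace) (n : ℕ) : ‖taylorCoeff f n‖ ≤ ‖f‖ := by
  have := lp.norm_apply_le_norm (by norm_num) (fourierBasis.repr (boundary f)) (n : ℤ)
  rwa [repr_boundary, LinearIsometryEquiv.norm_map, LinearIsometry.norm_map] at this

/-- Comparison of the Taylor series with a geometric series. The constant is not sharp; only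
continuity of evaluation matters. -/
theorem norm_apply_le (f : HardySpace) {z : ℂ} (hz : z ∈ ball (0 : ℂ) 1) :
    ‖f z‖ ≤ (1 - ‖z‖)⁻¹ * ‖f‖ := by
  have hz' : ‖z‖ < 1 := by simpa using hz
  have h := hasSum_taylorCoeff f.isHardy.differentiableOn hz
  rw [← h.tsum_eq]
  refine tsum_of_norm_bounded ((hasSum_geometric_of_lt_one (norm_nonneg z) hz').mul_right ‖f‖)
    fun n => ?_
  rw [norm_mul, norm_pow, mul_comm]
  gcongr
  exact f.norm_taylorCoeff_le n

/-- Evaluation at a point of the disc, as a continuous linear functional. -/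
def eval (z : ℂ) (hz : z ∈ ball (0 : ℂ) 1) : HardySpace →L[ℂ] ℂ :=
  LinearMap.mkContinuous
    { toFun := fun f => f z
      map_add' := fun f g => add_apply f g z
      map_smul' := fun c f => smul_apply c f z }
    (1 - ‖z‖)⁻¹ (fun f => f.norm_apply_le hz)

theorem eval_apply {z : ℂ} (hz : z ∈ ball (0 : ℂ) 1) (f : HardySpace) : eval z hz f = f z := rfl

/-- The constant function `1` on the disc. -/
def one : HardySpace :=
  ⟨(ball (0 : ℂ) 1).indicator 1, by
    refine ⟨(differentiableOn_const 1).congr fun z hz => Set.indicator_of_mem hz _,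
      fun z hz => Set.indicator_of_notMem hz _, 1, ?_⟩
    rintro _ ⟨r, rfl⟩
    simp only [circleMean, Set.indicator_of_mem (mul_toCircle_mem r.2 _)]
    simp⟩

theorem one_apply {z : ℂ} (hz : z ∈ ball (0 : ℂ) 1) : one z = 1 := Set.indicator_of_mem hz _

theorem exists_norm_eval_le (P : Polynomial ℂ) :
    ∃ C, ∀ z ∈ ball (0 : ℂ) 1, ‖P.eval z‖ ≤ C := by
  obtain ⟨C, hC⟩ := (isCompact_closedBall (0 : ℂ) 1).exists_bound_of_continuousOn
    (f := fun z => P.eval z) P.continuous.continuousOn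
  exact ⟨C, fun z hz => hC z (Metric.ball_subset_closedBall hz)⟩

/-- Multiplication by a polynomial on the Hardy space. -/
def polyMul (P : Polynomial ℂ) : HardySpace →L[ℂ] HardySpace :=
  mulOp (fun z => P.eval z) P.differentiable.differentiableOn _ (exists_norm_eval_le P).choose_spec

theorem polyMul_apply (P : Polynomial ℂ) (f : HardySpace) (z : ℂ) :
    polyMul P f z = P.eval z * f z := rfl

theorem polyMul_mul (P Q : Polynomial ℂ) (f : HardySpace) :
    polyMul (P * Q) f = polyMul P (polyMul Q f) := by
  ext z _
  simp [polyMul_apply, mul_assoc]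

theorem polyMul_add (P Q : Polynomial ℂ) (f : HardySpace) :
    polyMul (P + Q) f = polyMul P f + polyMul Q f := by
  ext z _
  simp [polyMul_apply, add_apply, add_mul]

theorem polyMul_smul (c : ℂ) (P : Polynomial ℂ) (f : HardySpace) :
    polyMul (c • P) f = c • polyMul P f := by
  ext z _
  simp [polyMul_apply, smul_apply, mul_assoc]

/-! ### Toeplitz operators with polynomial symbol are multiplications -/

/-- The continuous function `ζ ↦ P(rζ)` on the circle. -/
def circlePoly (P : Polynomial ℂ) (r : ℝ) : C(UnitAddCircle, ℂ) :=
  ⟨fun x => P.eval (r * (AddCircle.toCircle x : ℂ)), P.continuous.comp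
    (continuous_const.mul (continuous_subtype_val.comp AddCircle.continuous_toCircle))⟩

/-- Unlike `dilate`, this family includes $r = 1$, so continuity yields $P(r\zeta) \to P(\zeta)$
uniformly on the circle. -/
theorem continuous_circlePoly (P : Polynomial ℂ) : Continuous (circlePoly P) := by
  refine ContinuousMap.continuous_of_continuous_uncurry _ ?_
  refine P.continuous.comp ((Complex.continuous_ofReal.comp continuous_fst).mul
    (continuous_subtype_val.comp (AddCircle.continuous_toCircle.comp continuous_snd)))

theorem holderL_toLp (g k : C(UnitAddCircle, ℂ)) :
    (ContinuousLinearMap.mul ℂ ℂ).holderL AddCircle.haarAddCircle ∞ 2 2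
      (ContinuousMap.toLp ∞ AddCircle.haarAddCircle ℂ g)
      (ContinuousMap.toLp 2 AddCircle.haarAddCircle ℂ k)
      = ContinuousMap.toLp 2 AddCircle.haarAddCircle ℂ (g * k) := by
  refine Lp.ext ?_
  filter_upwards [(ContinuousLinearMap.mul ℂ ℂ).coeFn_holder
      (ContinuousMap.toLp ∞ AddCircle.haarAddCircle ℂ g)
      (ContinuousMap.toLp 2 AddCircle.haarAddCircle ℂ k) (r := 2),
    ContinuousMap.coeFn_toLp (𝕜 := ℂ) (p := ∞) AddCircle.haarAddCircle g,
    ContinuousMap.coeFn_toLp (𝕜 := ℂ) (p := 2) AddCircle.haarAddCircle k,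
    ContinuousMap.coeFn_toLp (𝕜 := ℂ) (p := 2) AddCircle.haarAddCircle (g * k)] with x h1 h2 h3 h4
  refine h1.trans ?_
  rw [h2, h3, h4]
  rfl

instance neBot_comap_val_Ico :
    (Filter.comap (Subtype.val : Set.Ico (0 : ℝ) 1 → ℝ) (𝓝 (1 : ℝ))).NeBot := by
  rw [Filter.comap_neBot_iff]
  intro t ht
  obtain ⟨r, hr, h⟩ := (Filter.nonempty_of_mem (Filter.inter_mem
    (Ico_mem_nhdsLT (show (0 : ℝ) < 1 by norm_num)) (mem_nhdsWithin_of_mem_nhds ht)))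
  exact ⟨⟨r, hr⟩, h⟩

/-- On dilates the identity is a pointwise product of continuous functions. It passes to the limit
$r \to 1$ because $P(r\,\cdot)$ converges in $L^\infty$, the dilates of $f$ converge in $L^2$, and
the Hölder product is jointly continuous. -/
theorem boundary_polyMul (P : Polynomial ℂ) (f : HardySpace) :
    boundary (polyMul P f) = (ContinuousLinearMap.mul ℂ ℂ).holderL AddCircle.haarAddCircle ∞ 2 2
      (polynomialSymbol P) (boundary f) := by
  refine tendsto_nhds_unique (tendsto_boundary (polyMul P f)) ?_
  have h1 : Filter.Tendsto (fun r : Set.Ico (0 : ℝ) 1 =>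
      ContinuousMap.toLp ∞ AddCircle.haarAddCircle ℂ (circlePoly P r))
      (Filter.comap Subtype.val (𝓝 (1 : ℝ))) (𝓝 (polynomialSymbol P)) := by
    have hc : polynomialSymbol P
        = ContinuousMap.toLp ∞ AddCircle.haarAddCircle ℂ (circlePoly P 1) := by
      simp [polynomialSymbol, circlePoly]
    rw [hc]
    exact ((ContinuousLinearMap.continuous _).comp (continuous_circlePoly P)).tendsto 1 |>.comp
      Filter.tendsto_comap
  have h2 := (((ContinuousLinearMap.mul ℂ ℂ).holderL AddCircle.haarAddCircle ∞ 2 2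
    (E := ℂ) (F := ℂ) (G := ℂ)).isBoundedBilinearMap.continuous.tendsto
    (polynomialSymbol P, boundary f)).comp (h1.prodMk_nhds (tendsto_boundary f))
  refine h2.congr fun r => ?_
  rw [Function.comp_apply, holderL_toLp]
  rfl

/-- The product of $P$ with a boundary function is again the boundary function of an element of
$H^2$, so the projection leaves it unchanged. -/
theorem toeplitz_polynomialSymbol (P : Polynomial ℂ) :
    toeplitz (polynomialSymbol P) = polyMul P := by
  ext1 f
  refine (LinearIsometryEquiv.symm_apply_eq boundaryEquiv).2 ?_
  have h : (ContinuousLinearMap.mul ℂ ℂ).holderL AddCircle.haarAddCircle ∞ 2 2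
      (polynomialSymbol P) (boundary f) = boundaryEquiv (polyMul P f) :=
    (boundary_polyMul P f).symm
  exact (congrArg hardyBoundary.orthogonalProjectionOnto h).trans
    (Submodule.orthogonalProjectionOnto_mem_subspace_eq_self _)

/-! ### Density of polynomials -/

theorem boundary_one : boundary one = ContinuousMap.toLp 2 AddCircle.haarAddCircle ℂ 1 := by
  refine tendsto_nhds_unique (tendsto_boundary one) (tendsto_const_nhds.congr fun r => ?_)
  congr 1
  ext x
  exact (one_apply (mul_toCircle_mem r.2 x)).symm

theorem boundary_polyMul_one (P : Polynomial ℂ) : boundary (polyMul P one)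
    = ContinuousMap.toLp 2 AddCircle.haarAddCircle ℂ (circlePoly P 1) := by
  have hc : polynomialSymbol P
      = ContinuousMap.toLp ∞ AddCircle.haarAddCircle ℂ (circlePoly P 1) := by
    simp [polynomialSymbol, circlePoly]
  rw [boundary_polyMul, boundary_one, hc, holderL_toLp, mul_one]

theorem boundary_X_pow (n : ℕ) :
    boundary (polyMul (Polynomial.X ^ n) one) = fourierBasis (T := 1) (n : ℤ) := by
  rw [boundary_polyMul_one, coe_fourierBasis, fourierLp]
  congr 1
  ext x
  simp [circlePoly, fourier_apply, AddCircle.toCircle_nsmul]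

/-- The Fourier expansion of the boundary function involves only the boundary values of monomials;
the isometry pulls its convergence back to $H^2$. -/
theorem hasSum_X_pow (f : HardySpace) :
    HasSum (fun n : ℕ => taylorCoeff f n • polyMul (Polynomial.X ^ n) one) f := by
  refine (boundary.isometry.isEmbedding.isInducing.hasSum_iff _ f).1 ?_
  have h := fourierBasis.hasSum_repr (boundary f)
  have hs : Function.support (fun k : ℤ => fourierBasis.repr (boundary f) k • fourierBasis (T := 1) k)
      ⊆ Set.range (Nat.cast : ℕ → ℤ) := by
    intro k hk
    by_contra hn
    apply hk
    cases k with
    | ofNat n => exact absurd ⟨n, rfl⟩ hn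
    | negSucc n => simp [repr_boundary, boundaryCoeff]
  have h' := (Function.Injective.hasSum_iff Nat.cast_injective (fun x hx => by
    by_contra h0; exact hx (hs h0))).2 h
  convert h' using 1
  funext n
  simp only [Function.comp_apply, map_smul, boundary_X_pow, repr_boundary]
  rfl

/-- A continuous functional which vanishes on the polynomials is zero. -/
theorem dual_ext_polynomial {φ : HardySpace →L[ℂ] ℂ} (h : ∀ Q, φ (polyMul Q one) = 0) : φ = 0 := by
  ext f
  have := (hasSum_X_pow f).mapL φ
  simp only [map_smul, h, smul_zero] at this
  exact this.unique hasSum_zero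

end HardySpace

/-! ### Annihilators of ranges along a semigroup -/

section Annihilator

variable {E : Type*} [NormedAddCommGroup E] [NormedSpace ℂ E]

/-- The continuous functionals which vanish on the range of an operator. -/
def annihilator (A : E →L[ℂ] E) : Submodule ℂ (E →L[ℂ] ℂ) where
  carrier := {φ | ∀ x, φ (A x) = 0}
  add_mem' h₁ h₂ x := by simp [h₁ x, h₂ x]
  zero_mem' _ := rfl
  smul_mem' c _ h x := by simp [h x]

theorem mem_annihilator {A : E →L[ℂ] E} {φ : E →L[ℂ] ℂ} :
    φ ∈ annihilator A ↔ ∀ x, φ (A x) = 0 := Iff.rfl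

variable {S : ℝ≥0 → E →L[ℂ] E}

theorem IsC0Semigroup.annihilator_mono (hS : IsC0Semigroup S) :
    Monotone fun t => annihilator (S t) := by
  intro t s hts φ hφ x
  obtain ⟨u, rfl⟩ := exists_add_of_le hts
  rw [hS.map_add]
  exact hφ _

/-- A trivial annihilator means dense range, a property inherited by powers: $\varphi T_{(n+1)t} =
(\varphi T_{nt})T_t$ vanishes only if $\varphi T_{nt}$ does. -/
theorem IsC0Semigroup.annihilator_nsmul_eq_bot (hS : IsC0Semigroup S) {t : ℝ≥0}
    (h : annihilator (S t) = ⊥) (n : ℕ) : annihilator (S (n • t)) = ⊥ := by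
  induction n with
  | zero =>
    rw [zero_smul, hS.map_zero, Submodule.eq_bot_iff]
    exact fun φ hφ => ContinuousLinearMap.ext hφ
  | succ n ih =>
    rw [Submodule.eq_bot_iff] at h ih ⊢
    intro φ hφ
    refine ih φ fun x => ?_
    have h0 : φ ∘L S (n • t) = 0 := by
      refine h _ fun y => ?_
      have := hφ y
      rwa [succ_nsmul, hS.map_add] at this
    exact congrArg (fun ψ : E →L[ℂ] ℂ => ψ x) h0

/-- The range of the time-one operator of a `C₀`-semigroup has codimension zero or infinity. -/
theorem IsC0Semigroup.annihilator_one_eq_bot (hS : IsC0Semigroup S)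
    [hfin : FiniteDimensional ℂ (annihilator (S 1))] : annihilator (S 1) = ⊥ := by
  by_contra hne
  -- The times $1/(n+1)$ tend to $0$ and each has $1$ as an integer multiple, so nontriviality at
  -- time $1$ forces it at every $\tau_n$.
  set τ : ℕ → ℝ≥0 := fun n => (n + 1 : ℝ≥0)⁻¹ with hτ
  have hτ1 : ∀ n, τ n ≤ 1 := fun n => inv_le_one_of_one_le₀ (by simp)
  have hmono : Antitone τ := fun m n hmn => by
    simp only [hτ]
    gcongr
  have hne' : ∀ n, annihilator (S (τ n)) ≠ ⊥ := fun n h0 => hne <| by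
    have := hS.annihilator_nsmul_eq_bot h0 (n + 1)
    have e : (n + 1) • τ n = 1 := by
      rw [nsmul_eq_mul]
      push_cast
      exact mul_inv_cancel₀ (by positivity)
    rwa [e] at this
  have hfd : ∀ n, FiniteDimensional ℂ (annihilator (S (τ n))) := fun n =>
    Submodule.finiteDimensional_of_le (hS.annihilator_mono (hτ1 n))
  -- At an index of minimal dimension the decreasing chain of annihilators has stabilised.
  obtain ⟨n, hn⟩ : ∃ n, ∀ m, Module.finrank ℂ (annihilator (S (τ n)))
      ≤ Module.finrank ℂ (annihilator (S (τ m))) :=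
    ⟨_, fun m => Function.argmin_le (fun n => Module.finrank ℂ (annihilator (S (τ n)))) m⟩
  obtain ⟨φ, hφ, hφ0⟩ := Submodule.exists_mem_ne_zero_of_ne_bot (hne' n)
  apply hφ0
  ext x
  have hτ0 : Filter.Tendsto τ Filter.atTop (𝓝 0) := by
    rw [← NNReal.tendsto_coe]
    simpa [hτ] using tendsto_one_div_add_atTop_nhds_zero_nat (𝕜 := ℝ)
  have hlim := (φ.continuous.tendsto _).comp (((hS.continuous x).tendsto 0).comp hτ0)
  rw [hS.map_zero] at hlim
  refine tendsto_nhds_unique hlim (tendsto_const_nhds.congr' ?_)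
  -- From $n$ on, $\varphi$ kills the range of every $T_{\tau_m}$, so $\varphi(x) = \lim
  -- \varphi(T_{\tau_m}x) = 0$.
  filter_upwards [Filter.eventually_ge_atTop n] with m hm
  have e := Submodule.eq_of_le_of_finrank_le (hS.annihilator_mono (hmono hm)) (hn m)
  exact (mem_annihilator.1 (e.ge hφ) x).symm

end Annihilator

/-! ### Finite codimension for polynomials, and necessity -/

namespace HardySpace

/-- A functional on the Hardy space restricted to polynomials. -/
def polyFunctional (φ : HardySpace →L[ℂ] ℂ) : Polynomial ℂ →ₗ[ℂ] ℂ where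
  toFun Q := φ (polyMul Q one)
  map_add' Q R := by rw [polyMul_add, map_add]
  map_smul' c Q := by rw [polyMul_smul, map_smul]; rfl

theorem polyFunctional_apply (φ : HardySpace →L[ℂ] ℂ) (Q : Polynomial ℂ) :
    polyFunctional φ Q = φ (polyMul Q one) := rfl

/-- Divide $Q$ by $P$: the multiple of $P$ is annihilated, and the remainder is a combination of the
monomials of degree below $\deg P$. -/
theorem eq_zero_of_mem_annihilator_polyMul {P : Polynomial ℂ} (hP : P ≠ 0)
    {φ : HardySpace →L[ℂ] ℂ} (hφ : φ ∈ annihilator (polyMul P))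
    (h : ∀ i < P.natDegree, φ (polyMul (Polynomial.X ^ i) one) = 0) : φ = 0 := by
  refine dual_ext_polynomial fun Q => ?_
  -- The zero remainder is separate because its `natDegree` is $0$, which is not below `P.natDegree`
  -- when $P$ is constant.
  by_cases hQ : Q % P = 0
  · rw [← EuclideanDomain.div_add_mod Q P, hQ, add_zero, polyMul_mul]
    exact hφ _
  have hd : (Q % P).natDegree < P.natDegree :=
    Polynomial.natDegree_lt_natDegree hQ (EuclideanDomain.mod_lt Q hP)
  rw [← EuclideanDomain.div_add_mod Q P, polyMul_add, map_add, polyMul_mul, hφ, zero_add,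
    ← polyFunctional_apply, (Q % P).as_sum_range' _ hd, map_sum]
  refine Finset.sum_eq_zero fun i hi => ?_
  rw [← Polynomial.smul_X_eq_monomial, map_smul, polyFunctional_apply, h i (Finset.mem_range.1 hi),
    smul_zero]

theorem finiteDimensional_annihilator_polyMul {P : Polynomial ℂ} (hP : P ≠ 0) :
    FiniteDimensional ℂ (annihilator (polyMul P)) := by
  let Λ : annihilator (polyMul P) →ₗ[ℂ] (Fin P.natDegree → ℂ) :=
    { toFun := fun φ i => φ.1 (polyMul (Polynomial.X ^ (i : ℕ)) one)
      map_add' := fun _ _ => rfl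
      map_smul' := fun _ _ => rfl }
  refine FiniteDimensional.of_injective Λ fun φ ψ h => sub_eq_zero.1 (Subtype.ext ?_)
  refine eq_zero_of_mem_annihilator_polyMul hP (φ - ψ).2 fun i hi => ?_
  exact sub_eq_zero.2 (congrFun h ⟨i, hi⟩)

theorem eval_ne_zero_of_isEmbeddable {P : Polynomial ℂ} (hP : P ≠ 0)
    (h : IsEmbeddable (polyMul P)) {z : ℂ} (hz : z ∈ ball (0 : ℂ) 1) : P.eval z ≠ 0 := by
  intro h0
  obtain ⟨S, hS, h1⟩ := h
  have := finiteDimensional_annihilator_polyMul hP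
  rw [← h1] at this
  have hmem : eval z hz ∈ annihilator (S 1) := fun f => by
    rw [h1, eval_apply, polyMul_apply, h0, zero_mul]
  rw [hS.annihilator_one_eq_bot, Submodule.mem_bot] at hmem
  have := congrArg (fun ψ : HardySpace →L[ℂ] ℂ => ψ one) hmem
  simp only [eval_apply, one_apply hz] at this
  exact one_ne_zero this

end HardySpace

/-! ### Holomorphic logarithms and criteria for strong continuity -/

/-- A zero-free holomorphic function on a disc has a holomorphic logarithm. -/
theorem exists_exp_eq_of_ne_zero {f : ℂ → ℂ} {c : ℂ} {r : ℝ} (hf : DifferentiableOn ℂ f (ball c r))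
    (h0 : ∀ z ∈ ball c r, f z ≠ 0) :
    ∃ L : ℂ → ℂ, DifferentiableOn ℂ L (ball c r) ∧ ∀ z ∈ ball c r, Complex.exp (L z) = f z := by
  rcases le_or_gt r 0 with hr | hr
  · exact ⟨0, differentiableOn_const 0, by simp [Metric.ball_eq_empty.2 hr]⟩
  have hc : c ∈ ball c r := Metric.mem_ball_self hr
  have hd : DifferentiableOn ℂ (fun z => deriv f z / f z) (ball c r) :=
    (hf.deriv Metric.isOpen_ball).div hf h0
  -- The primitive of $f'/f$ is normalised at the centre so that the constant function $e^{-L}f$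
  -- equals $1$.
  obtain ⟨L, hLc, hL⟩ := hd.isExactOn_ball.with_val_at c (Complex.log (f c))
  have hLd : DifferentiableOn ℂ L (ball c r) := fun z hz =>
    (hL z hz).differentiableAt.differentiableWithinAt
  refine ⟨L, hLd, fun z hz => ?_⟩
  have hderiv : ∀ w ∈ ball c r, HasDerivAt (fun w => Complex.exp (-L w) * f w) 0 w := by
    intro w hw
    have h1 := (hL w hw).neg.cexp.mul
      (hf.differentiableAt (Metric.isOpen_ball.mem_nhds hw)).hasDerivAt
    refine h1.congr_deriv ?_
    linear_combination -Complex.exp (-L w) * div_mul_cancel₀ (deriv f w) (h0 w hw)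
  have hconst := Metric.isOpen_ball.is_const_of_deriv_eq_zero (𝕜 := ℂ)
    (convex_ball c r).isPreconnected
    (fun w hw => (hderiv w hw).differentiableAt.differentiableWithinAt)
    (fun w hw => (hderiv w hw).deriv) hz hc
  simp only [hLc, Complex.exp_neg, Complex.exp_log (h0 c hc), inv_mul_cancel₀ (h0 c hc)] at hconst
  exact ((inv_mul_eq_one₀ (Complex.exp_ne_zero _)).1 hconst)

/-- Weak convergence tested on a total set, together with convergence of an upper bound of the norms
to the norm of the limit, gives strong convergence. -/
theorem tendsto_of_tendsto_inner_of_norm_le {H ι : Type*} [NormedAddCommGroup H]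
    [InnerProductSpace ℂ H] {l : Filter ι} {x : ι → H} {y : H} {C : ι → ℝ}
    (hC : Filter.Tendsto C l (𝓝 ‖y‖)) (hx : ∀ i, ‖x i‖ ≤ C i) {K : Set H}
    (hK : (Submodule.span ℂ K).topologicalClosure = ⊤)
    (h : ∀ k ∈ K, Filter.Tendsto (fun i => inner ℂ k (x i)) l (𝓝 (inner ℂ k y))) :
    Filter.Tendsto x l (𝓝 y) := by
  have hspan : ∀ k ∈ Submodule.span ℂ K,
      Filter.Tendsto (fun i => inner ℂ k (x i - y)) l (𝓝 0) := by
    intro k hk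
    induction hk using Submodule.span_induction with
    | mem k hk => simpa [inner_sub_right] using (h k hk).sub_const (inner ℂ k y)
    | zero => simpa only [inner_zero_left] using tendsto_const_nhds
    | add k₁ k₂ _ _ h₁ h₂ => simpa only [inner_add_left, add_zero] using h₁.add h₂
    | smul c k _ hk =>
      simpa only [inner_smul_left, mul_zero] using hk.const_mul (starRingEnd ℂ c)
  have hbound : ∀ᶠ i in l, ‖x i - y‖ ≤ 2 * ‖y‖ + 1 := by
    filter_upwards [hC.eventually_le_const (lt_add_one ‖y‖)] with i hi
    linarith [norm_sub_le (x i) y, hx i]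
  -- Only the pairing with $y$ itself is needed. Approximating $y$ by $k$ in the span costs
  -- $\|y-k\|$ times the eventual bound on $\|x_i-y\|$.
  have hweak : Filter.Tendsto (fun i => inner ℂ y (x i - y)) l (𝓝 0) := by
    rw [Metric.tendsto_nhds]
    intro ε hε
    have hy : y ∈ closure (Submodule.span ℂ K : Set H) := by
      rw [← Submodule.topologicalClosure_coe, hK]
      trivial
    have hpos : 0 < 2 * ‖y‖ + 1 := by positivity
    obtain ⟨k, hk, hky⟩ := Metric.mem_closure_iff.1 hy (ε / 2 / (2 * ‖y‖ + 1)) (by positivity)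
    filter_upwards [Metric.tendsto_nhds.1 (hspan k hk) (ε / 2) (by positivity), hbound] with i h1 h2
    rw [dist_zero_right] at h1 ⊢
    rw [dist_eq_norm, lt_div_iff₀ hpos] at hky
    have h3 : inner ℂ y (x i - y) = inner ℂ (y - k) (x i - y) + inner ℂ k (x i - y) := by
      rw [← inner_add_left, sub_add_cancel]
    calc ‖inner ℂ y (x i - y)‖ ≤ ‖y - k‖ * ‖x i - y‖ + ‖inner ℂ k (x i - y)‖ := by
          rw [h3]
          exact (norm_add_le _ _).trans (add_le_add_left (norm_inner_le_norm _ _) _)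
      _ ≤ ‖y - k‖ * (2 * ‖y‖ + 1) + ‖inner ℂ k (x i - y)‖ := by gcongr
      _ < ε := by linarith
  -- Expand $\|y+(x_i-y)\|^2$ and bound $\|x_i\|$ by $C_i$.
  have hsq : ∀ i, ‖x i - y‖ ^ 2 ≤ C i ^ 2 - ‖y‖ ^ 2 - 2 * (inner ℂ y (x i - y)).re := by
    intro i
    have h1 := norm_add_sq (𝕜 := ℂ) y (x i - y)
    rw [add_sub_cancel] at h1
    have h2 := pow_le_pow_left₀ (norm_nonneg _) (hx i) 2
    simp only [RCLike.re_to_complex] at h1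
    linarith
  have hlim : Filter.Tendsto
      (fun i => C i ^ 2 - ‖y‖ ^ 2 - 2 * (inner ℂ y (x i - y)).re) l (𝓝 0) := by
    have := ((hC.pow 2).sub_const (‖y‖ ^ 2)).sub
      (((Complex.continuous_re.tendsto _).comp hweak).const_mul 2)
    simpa using this
  rw [tendsto_iff_norm_sub_tendsto_zero]
  have := (squeeze_zero (fun i => sq_nonneg ‖x i - y‖) hsq hlim).sqrt
  simpa [Real.sqrt_sq (norm_nonneg _)] using this

/-- A semigroup of operators with exponential bound which is strongly continuous at `0` is strongly
continuous. -/
theorem isC0Semigroup_of_tendsto_zero {E : Type*} [NormedAddCommGroup E] [NormedSpace ℂ E]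
    {S : ℝ≥0 → E →L[ℂ] E} (h0 : S 0 = ContinuousLinearMap.id ℂ E)
    (hadd : ∀ t s, S (t + s) = S t ∘L S s) {B : ℝ} (hB : ∀ t, ‖S t‖ ≤ Real.exp (t * B))
    (hlim : ∀ x, Filter.Tendsto (fun t => S t x) (𝓝 0) (𝓝 x)) : IsC0Semigroup S := by
  refine ⟨h0, hadd, fun x => continuous_iff_continuousAt.2 fun s => ?_⟩
  -- Subtraction in `ℝ≥0` is truncated, so $(t-s)+(s-t)$ is $|t-s|$. Using $|B|$ makes the
  -- exponential bound monotone in time even for negative $B$.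
  have key : ∀ t, ‖S t x - S s x‖
      ≤ Real.exp (max t s * |B|) * ‖S ((t - s) + (s - t)) x - x‖ := by
    have aux : ∀ a b : ℝ≥0, a ≤ b → ‖S b x - S a x‖ ≤ Real.exp (b * |B|) * ‖S (b - a) x - x‖ := by
      intro a b hab
      have e : S b x - S a x = S a (S (b - a) x - x) := by
        rw [map_sub, ← ContinuousLinearMap.comp_apply, ← hadd, add_tsub_cancel_of_le hab]
      rw [e]
      refine (S a).le_of_opNorm_le ((hB a).trans (Real.exp_le_exp.2 ?_)) _
      exact (mul_le_mul_of_nonneg_left (le_abs_self B) a.2).trans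
        (mul_le_mul_of_nonneg_right (by exact_mod_cast hab) (abs_nonneg B))
    intro t
    rcases le_total s t with hst | hst
    · rw [tsub_eq_zero_of_le hst, add_zero, NNReal.coe_max, max_eq_left (by exact_mod_cast hst)]
      exact aux s t hst
    · rw [tsub_eq_zero_of_le hst, zero_add, NNReal.coe_max, max_eq_right (by exact_mod_cast hst),
        norm_sub_rev]
      exact aux t s hst
  rw [ContinuousAt, tendsto_iff_norm_sub_tendsto_zero]
  refine squeeze_zero (fun t => norm_nonneg _) key ?_
  have hd : Filter.Tendsto (fun t : ℝ≥0 => (t - s) + (s - t)) (𝓝 s) (𝓝 0) := by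
    have : Continuous fun t : ℝ≥0 => (t - s) + (s - t) := by fun_prop
    simpa using this.tendsto s
  have h1 := (tendsto_iff_norm_sub_tendsto_zero.1 (hlim x)).comp hd
  have h2 : Filter.Tendsto (fun t : ℝ≥0 => Real.exp ((max t s : ℝ≥0) * |B|)) (𝓝 s)
      (𝓝 (Real.exp ((max s s : ℝ≥0) * |B|))) := by
    have : Continuous fun t : ℝ≥0 => Real.exp ((max t s : ℝ≥0) * |B|) := by fun_prop
    exact this.tendsto s
  simpa using h2.mul h1

/-! ### Reproducing kernels and sufficiency -/

namespace HardySpace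

/-- The function representing evaluation at a point, in the space of boundary functions. -/
def boundaryKernel (z : ball (0 : ℂ) 1) : hardyBoundary :=
  (InnerProductSpace.toDual ℂ hardyBoundary).symm
    ((eval z z.2).comp boundaryEquiv.symm.toContinuousLinearEquiv.toContinuousLinearMap)

theorem inner_boundaryKernel (z : ball (0 : ℂ) 1) (f : HardySpace) :
    inner ℂ (boundaryKernel z) (boundaryEquiv f) = f z := by
  rw [boundaryKernel, InnerProductSpace.toDual_symm_apply]
  change eval z z.2 (boundaryEquiv.symm (boundaryEquiv f)) = f z
  rw [LinearIsometryEquiv.symm_apply_apply, eval_apply]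

/-- A function orthogonal to all kernels vanishes at every point of the disc. Hence pointwise
convergence can serve as weak convergence on a total set. -/
theorem span_boundaryKernel_topologicalClosure :
    (Submodule.span ℂ (Set.range boundaryKernel)).topologicalClosure = ⊤ := by
  rw [Submodule.topologicalClosure_eq_top_iff, Submodule.eq_bot_iff]
  intro g hg
  obtain ⟨f, rfl⟩ := boundaryEquiv.surjective g
  have : f = 0 := by
    ext z hz
    rw [← inner_boundaryKernel ⟨z, hz⟩]
    exact (Submodule.mem_orthogonal _ _).1 hg _ (Submodule.subset_span ⟨_, rfl⟩)
  rw [this, map_zero]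

/-- Pointwise convergence together with convergence of an upper bound of the norms to the norm of the
limit implies convergence in the Hardy space. -/
theorem tendsto_of_tendsto_apply_of_norm_le {ι : Type*} {l : Filter ι} {f : ι → HardySpace}
    {g : HardySpace} {C : ι → ℝ} (hC : Filter.Tendsto C l (𝓝 ‖g‖)) (hf : ∀ i, ‖f i‖ ≤ C i)
    (h : ∀ z ∈ ball (0 : ℂ) 1, Filter.Tendsto (fun i => f i z) l (𝓝 (g z))) :
    Filter.Tendsto f l (𝓝 g) := by
  refine (boundaryEquiv.toHomeomorph.isInducing.tendsto_nhds_iff).2 ?_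
  refine tendsto_of_tendsto_inner_of_norm_le (C := C) ?_ ?_
    span_boundaryKernel_topologicalClosure ?_
  · exact (boundaryEquiv.norm_map g).symm ▸ hC
  · exact fun i => (boundaryEquiv.norm_map (f i)).trans_le (hf i)
  · rintro _ ⟨z, rfl⟩
    have := h z z.2
    simp only [← inner_boundaryKernel z] at this
    exact this

/-- Multiplication by `exp L`, for `L` holomorphic with real part bounded above, is embeddable. -/
theorem isC0Semigroup_mulOp_exp {L : ℂ → ℂ} (hL : DifferentiableOn ℂ L (ball 0 1)) {B : ℝ}
    (hB : ∀ z ∈ ball (0 : ℂ) 1, (L z).re ≤ B) :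
    IsC0Semigroup fun t : ℝ≥0 => mulOp (fun z => Complex.exp ((t : ℝ) * L z))
      (hL.const_mul _).cexp (Real.exp (t * B)) (fun z hz => by
        rw [Complex.norm_exp, Complex.re_ofReal_mul, Real.exp_le_exp]
        exact mul_le_mul_of_nonneg_left (hB z hz) t.2) := by
  refine isC0Semigroup_of_tendsto_zero ?_ ?_ (fun t => norm_mulOp_le _ _) fun f => ?_
  · ext f z _
    simp [mulOp_apply]
  · intro t s
    ext f z _
    simp only [mulOp_apply, ContinuousLinearMap.comp_apply, ← mul_assoc, ← Complex.exp_add]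
    push_cast
    ring_nf
  -- At $t = 0$ the bound $e^{tB}\|f\|$ becomes exactly $\|f\|$, as the criterion requires.
  · refine tendsto_of_tendsto_apply_of_norm_le (C := fun t : ℝ≥0 => Real.exp (t * B) * ‖f‖) ?_
      (fun t => ContinuousLinearMap.le_of_opNorm_le _ (norm_mulOp_le _ _) f) fun z hz => ?_
    · have : Continuous fun t : ℝ≥0 => Real.exp (t * B) * ‖f‖ := by fun_prop
      simpa using this.tendsto 0
    · simp only [mulOp_apply]
      have : Continuous fun t : ℝ≥0 => Complex.exp ((t : ℝ) * L z) * f z := by fun_prop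
      simpa using this.tendsto 0

/-- With $P = e^L$ and $|P| \le C$ on the disc, $\mathrm{Re}\, L \le \log C$, and time $1$ of the
semigroup of the $e^{tL}$ is $P$. -/
theorem isEmbeddable_polyMul {P : Polynomial ℂ} (hP : ∀ z ∈ ball (0 : ℂ) 1, P.eval z ≠ 0) :
    IsEmbeddable (polyMul P) := by
  obtain ⟨L, hL, he⟩ := exists_exp_eq_of_ne_zero P.differentiable.differentiableOn hP
  obtain ⟨C, hC⟩ := exists_norm_eval_le P
  have hB : ∀ z ∈ ball (0 : ℂ) 1, (L z).re ≤ Real.log C := fun z hz => by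
    have := hC z hz
    rw [← he z hz, Complex.norm_exp] at this
    exact (Real.le_log_iff_exp_le ((Real.exp_pos _).trans_le this)).2 this
  refine ⟨_, isC0Semigroup_mulOp_exp hL hB, ?_⟩
  ext f z hz
  rw [mulOp_apply, polyMul_apply, ← he z hz]
  simp

end HardySpace

end

end HardyToeplitz

theorem mainTheorem6 (P : Polynomial ℂ) (hP : P ≠ 0) :
    HardyToeplitz.IsEmbeddable (HardyToeplitz.toeplitz (HardyToeplitz.polynomialSymbol P)) ↔
      ∀ z ∈ Metric.ball (0 : ℂ) 1, P.eval z ≠ 0 := by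
  rw [HardyToeplitz.HardySpace.toeplitz_polynomialSymbol]
  exact ⟨fun h _ hz => HardyToeplitz.HardySpace.eval_ne_zero_of_isEmbeddable hP h hz,
    HardyToeplitz.HardySpace.isEmbeddable_polyMul⟩
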